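/- For each $n$ let $p=p(n)\in[0,1]$, and let $\mathcal G(n,p)$ be the Erdős–Rényi random graph on $n$ vertices, in which each of the $\binom n2$ possible edges is present independently with probability $p$. For a graph $\mathcal G$ on a set $\mathcal V$ of $n\ge 2$ vertices let $d_{\min}$ and $d_{\max}$ be its minimum and maximum degree, and let $$i(\mathcal G)=\min_{\emptyset\ne A\subset\mathcal V,\ |A|\le n/2}\frac{|\partial A|}{|A|}$$ be its isoperimetric constant, where $\partial A$ is the set of edges with one endpoint in $A$ and the other in $\mathcal V\setminus A$. Suppose that $$\limsup_{n\to\infty}\frac{\ln n}{np}<1$$ (where $\frac{\ln n}{np}$ is read as $+\infty$ if $p(n)=0$ and $n\ge 2$). Then there exists a constant $\alpha>0$, depending only on the function $p$, such that for every fixed $\epsilon\in(0,\tfrac12]$, $$\alpha np\le i(\mathcal G)\le d_{\min}\le d_{\max}\le np\left(1+\sqrt3\left(\frac{\ln n}{np}\right)^{\frac12-\epsilon}\right)$$ holds asymptotically almost surely, that is, the probability that $\mathcal G=\mathcal G(n,p)$ satisfies these four inequalities tends to $1$ as $n\to\infty$. -/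

import Mathlib

/-- The edge boundary `∂S` of a set `S` of vertices: all edges `(u, v)` with `u ∈ S` and `v ∉ S`.
Each boundary edge occurs exactly once, oriented from `S` to its complement. -/
noncomputable def SimpleGraph.edgeBoundary {V : Type*} [Fintype V] (G : SimpleGraph V)
    (S : Finset V) : Finset (V × V) :=
  open scoped Classical in Finset.univ.filter fun e => G.Adj e.1 e.2 ∧ e.1 ∈ S ∧ e.2 ∉ S

/-- The isoperimetric constant `i(G)`: the minimum of `|∂A| / |A|` over all nonempty sets `A` of at
most `n / 2` vertices, where `n` is the number of vertices. The infimum is over a finite set of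
reals, which is nonempty (so that the infimum is a minimum) as soon as `n ≥ 2`. -/
noncomputable def SimpleGraph.isoperimetricConstant {V : Type*} [Fintype V]
    (G : SimpleGraph V) : ℝ :=
  sInf {r : ℝ | ∃ A : Finset V, A.Nonempty ∧ (A.card : ℝ) ≤ (Fintype.card V : ℝ) / 2 ∧
    r = ((G.edgeBoundary A).card : ℝ) / (A.card : ℝ)}

/-- A graph property `P` holds asymptotically almost surely for the Erdős–Rényi random graph
`G(n, p)`, with `p = p n`, if its probability tends to `1` as `n → ∞`. -/
def AsymptoticallyAlmostSurely (p : ℕ → unitInterval)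
    (P : (n : ℕ) → SimpleGraph (Fin n) → Prop) : Prop :=
  Filter.Tendsto (fun n : ℕ => SimpleGraph.binomialRandom (Fin n) (p n) {G | P n G})
    Filter.atTop (nhds 1)

/-!
The number of edges between `A` and its complement is binomial, so its moment generating function is
dominated by that of a Poisson variable, and the Chernoff bound for deviating from the mean `m` by a
factor `a` is `exp (-m * klFun a)`.

For the maximum degree take `a = 1 + c * √3` with `c = √(log n / (n * p)) ≤ 1`. Since
`klFun (1 + c * x) ≥ c ^ 2 * klFun (1 + x)`, the exponent is at least `klFun (1 + √3) * log n`, and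
`klFun (1 + √3) > 1` because `1 + √3 > e`; this beats the union bound over the `n` vertices.

For the isoperimetric constant let `n * p ≥ ρ * log n` with `ρ > 1`, choose `β < 1` with
`β ^ 2 * ρ > 1`, and then `a > 0` with `klFun a ≥ β`, which is possible because `klFun 0 = 1`. A set
`A` with `|A| ≤ (1 - β) * n` has at least `β * n * p * |A|` boundary edges on average, so it fails
with probability at most `exp (-β ^ 2 * n * p) ^ |A|`; the sum of these over all `A` is at most
`exp (n * exp (-β ^ 2 * n * p)) - 1`, which tends to `0`. The larger sets fail with probability
`exp (-Θ(n * p)) ^ n`, which beats the number `2 ^ n` of all sets.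
-/

open MeasureTheory ProbabilityTheory InformationTheory Filter Topology
open scoped Finset SimpleGraph

section KLFun

lemma sq_mul_klFun_one_add_le {x c : ℝ} (hx : 0 ≤ x) (hc0 : 0 ≤ c) (hc1 : c ≤ 1) :
    c ^ 2 * klFun (1 + x) ≤ klFun (1 + c * x) := by
  let f : ℝ → ℝ := fun y => klFun (1 + c * y) - c ^ 2 * klFun (1 + y)
  have hderiv : ∀ y, 0 ≤ y →
      HasDerivAt f (c * (Real.log (1 + c * y) - c * Real.log (1 + y))) y := by
    intro y hy
    have h1 : HasDerivAt (fun z => 1 + c * z) c y := by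
      simpa using ((hasDerivAt_id y).const_mul c).const_add 1
    have h2 : HasDerivAt (fun z => 1 + z) 1 y := (hasDerivAt_id y).const_add 1
    have h := ((hasDerivAt_klFun (by positivity)).comp y h1).sub
      (((hasDerivAt_klFun (by positivity)).comp y h2).const_mul (c ^ 2))
    exact h.congr_deriv (by ring)
  have hlog : ∀ y, 0 ≤ y → c * Real.log (1 + y) ≤ Real.log (1 + c * y) := by
    intro y hy
    rw [← Real.log_rpow (by positivity)]
    exact Real.log_le_log (by positivity)
      (rpow_one_add_le_one_add_mul_self (by linarith) hc0 hc1)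
  have hmono : MonotoneOn f (Set.Ici 0) := by
    refine monotoneOn_of_hasDerivWithinAt_nonneg (convex_Ici 0)
      (fun y hy => (hderiv y hy).continuousAt.continuousWithinAt)
      (fun y hy => (hderiv y (interior_subset hy)).hasDerivWithinAt) fun y hy => ?_
    exact mul_nonneg hc0 (sub_nonneg.2 (hlog y (interior_subset hy)))
  have h0 : f 0 ≤ f x := hmono Set.self_mem_Ici hx hx
  simpa [f, klFun_one] using h0

lemma one_lt_klFun_one_add_sqrt_three : 1 < klFun (1 + √3) := by
  have hsqrt : 1.72 < √3 := Real.lt_sqrt_of_sq_lt (by norm_num)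
  have hlog : 1 < Real.log (1 + √3) := by
    rw [Real.lt_log_iff_exp_lt (by positivity)]
    linarith [Real.exp_one_lt_d9]
  rw [klFun_apply]
  nlinarith

end KLFun

section SubPoisson

/-- The moment generating function of `X` is at most that of a Poisson variable of mean `r`, which
is what the Chernoff bounds for sums of independent indicators of total mean `r` rest on. -/
structure HasSubPoissonMGF {Ω : Type*} [MeasurableSpace Ω] (X : Ω → ℝ) (r : ℝ) (P : Measure Ω) :
    Prop where
  integrable_exp_mul : ∀ t, Integrable (fun ω => Real.exp (t * X ω)) P
  mgf_le : ∀ t, mgf X P t ≤ Real.exp (r * (Real.exp t - 1))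

namespace HasSubPoissonMGF

variable {Ω : Type*} [MeasurableSpace Ω] {P : Measure Ω} [IsFiniteMeasure P] {X : Ω → ℝ}
  {r s a : ℝ}

lemma measureReal_ge_le (h : HasSubPoissonMGF X r P) (hrs : r ≤ s) (ha : 1 ≤ a) :
    P.real {ω | a * s ≤ X ω} ≤ Real.exp (-(s * klFun a)) := by
  calc P.real {ω | a * s ≤ X ω}
      ≤ Real.exp (-Real.log a * (a * s)) * mgf X P (Real.log a) :=
        measure_ge_le_exp_mul_mgf _ (Real.log_nonneg ha) (h.integrable_exp_mul _)
    _ ≤ Real.exp (-Real.log a * (a * s)) * Real.exp (s * (a - 1)) := by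
        gcongr
        refine (h.mgf_le _).trans (Real.exp_le_exp.2 ?_)
        rw [Real.exp_log (by positivity)]
        exact mul_le_mul_of_nonneg_right hrs (sub_nonneg.2 ha)
    _ = Real.exp (-(s * klFun a)) := by
        rw [← Real.exp_add, klFun_apply]
        ring_nf

lemma measureReal_le_le (h : HasSubPoissonMGF X r P) (hsr : s ≤ r) (ha0 : 0 < a) (ha1 : a ≤ 1) :
    P.real {ω | X ω ≤ a * s} ≤ Real.exp (-(s * klFun a)) := by
  calc P.real {ω | X ω ≤ a * s}
      ≤ Real.exp (-Real.log a * (a * s)) * mgf X P (Real.log a) :=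
        measure_le_le_exp_mul_mgf _ (Real.log_nonpos ha0.le ha1) (h.integrable_exp_mul _)
    _ ≤ Real.exp (-Real.log a * (a * s)) * Real.exp (s * (a - 1)) := by
        gcongr
        refine (h.mgf_le _).trans (Real.exp_le_exp.2 ?_)
        rw [Real.exp_log ha0]
        exact mul_le_mul_of_nonpos_right hsr (sub_nonpos.2 ha1)
    _ = Real.exp (-(s * klFun a)) := by
        rw [← Real.exp_add, klFun_apply]
        ring_nf

end HasSubPoissonMGF

end SubPoisson

section SetBernoulli

variable {ι : Type*} [Finite ι]

lemma integral_setBernoulli [DecidableEq ι] (u : Finset ι) (p : unitInterval) (f : Set ι → ℝ) :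
    ∫ s, f s ∂setBer((u : Set ι), p) =
      ∑ s ∈ u.powerset, (p : ℝ) ^ #s * (1 - p) ^ #(u \ s) * f s := by
  classical
  cases nonempty_fintype ι
  have hsubset : ∀ s ∈ u.powerset, (p : ℝ) ^ #s * (1 - p) ^ #(u \ s) * f s =
      setBer((u : Set ι), p).real {(s : Set ι)} • f s := by
    intro s hs
    rw [setBernoulli_real_singleton p (by simpa using hs) u.finite_toSet, ← Finset.coe_sdiff,
      Set.ncard_coe_finset, Set.ncard_coe_finset, smul_eq_mul]
  rw [integral_fintype .of_finite, Finset.sum_congr rfl hsubset]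
  refine (Finset.sum_of_injOn (fun s : Finset ι => (s : Set ι)) (by simp) (by simp) ?_
    (by simp)).symm
  intro s _ hs
  have hsu : ¬ s ⊆ u := fun h => hs ⟨s.toFinset, by simpa using h, by simp⟩
  simp [measureReal_def, setBernoulli_singleton_of_not_subset p hsu]

lemma mgf_ncard_inter_setBernoulli (p : unitInterval) {u E : Set ι} (hE : E ⊆ u) (t : ℝ) :
    mgf (fun s : Set ι => ((s ∩ E).ncard : ℝ)) setBer(u, p) t =
      (1 + p * (Real.exp t - 1)) ^ E.ncard := by
  classical
  lift u to Finset ι using u.toFinite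
  lift E to Finset ι using E.toFinite
  have hEu : u ∩ E = E := Finset.inter_eq_right.2 (mod_cast hE)
  have hexp : ∀ s : Finset ι, Real.exp (t * ((s ∩ E : Set ι).ncard : ℝ)) =
      ∏ i ∈ s, if i ∈ E then Real.exp t else 1 := by
    intro s
    rw [Finset.prod_ite_mem, Finset.prod_const, ← Finset.coe_inter, Set.ncard_coe_finset, mul_comm,
      Real.exp_nat_mul]
  calc mgf (fun s : Set ι => ((s ∩ E).ncard : ℝ)) setBer((u : Set ι), p) t
      = ∑ s ∈ u.powerset, (∏ i ∈ s, (p : ℝ) * if i ∈ E then Real.exp t else 1) *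
          ∏ i ∈ u \ s, (1 - p : ℝ) := by
        rw [mgf, integral_setBernoulli]
        refine Finset.sum_congr rfl fun s _ => ?_
        rw [hexp, Finset.prod_mul_distrib, Finset.prod_const, Finset.prod_const]
        ring
    _ = ∏ i ∈ u, ((p : ℝ) * (if i ∈ E then Real.exp t else 1) + (1 - p)) :=
        (Finset.prod_add _ _ _).symm
    _ = ∏ i ∈ u, if i ∈ E then 1 + p * (Real.exp t - 1) else 1 :=
        Finset.prod_congr rfl fun i _ => by split_ifs <;> ring
    _ = (1 + p * (Real.exp t - 1)) ^ (E : Set ι).ncard := by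
        rw [Finset.prod_ite_mem, hEu, Finset.prod_const, Set.ncard_coe_finset]

lemma hasSubPoissonMGF_ncard_inter_setBernoulli (p : unitInterval) {u E : Set ι} (hE : E ⊆ u) :
    HasSubPoissonMGF (fun s : Set ι => ((s ∩ E).ncard : ℝ)) (p * E.ncard) setBer(u, p) where
  integrable_exp_mul _ := .of_finite
  mgf_le t := by
    have hbase : 0 ≤ 1 + p * (Real.exp t - 1) := by
      nlinarith [p.2.2, mul_nonneg p.2.1 (Real.exp_pos t).le]
    calc mgf (fun s : Set ι => ((s ∩ E).ncard : ℝ)) setBer(u, p) t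
        = (1 + p * (Real.exp t - 1)) ^ E.ncard := mgf_ncard_inter_setBernoulli p hE t
      _ ≤ Real.exp (p * (Real.exp t - 1)) ^ E.ncard := by
          gcongr
          linarith [Real.add_one_le_exp (p * (Real.exp t - 1))]
      _ = Real.exp (p * E.ncard * (Real.exp t - 1)) := by
          rw [← Real.exp_nat_mul]
          ring_nf

end SetBernoulli

section EdgeBoundary

variable {V : Type*}

instance measurableSingletonClass_simpleGraph [Countable V] :
    MeasurableSingletonClass (SimpleGraph V) where
  measurableSet_singleton G := by
    convert SimpleGraph.measurable_edgeSet (measurableSet_singleton G.edgeSet)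
    ext H
    simp

/-- The cut of `A`: all potential edges between `A` and its complement, that is, the edge boundary
of `A` in the complete graph, as unordered pairs so that it can be intersected with `edgeSet`. -/
def cut (A : Finset V) : Set (Sym2 V) :=
  (fun e : V × V => s(e.1, e.2)) '' {e | e.1 ∈ A ∧ e.2 ∉ A}

lemma cut_subset_compl_diagSet (A : Finset V) : cut A ⊆ Sym2.diagSetᶜ := by
  rintro _ ⟨⟨a, b⟩, ⟨ha, hb⟩, rfl⟩
  have hab : a ≠ b := fun h => hb (h ▸ ha)
  simpa using hab

lemma injOn_sym2Mk_mem_notMem (A : Finset V) :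
    Set.InjOn (fun e : V × V => s(e.1, e.2)) {e | e.1 ∈ A ∧ e.2 ∉ A} := by
  rintro ⟨a, b⟩ ⟨ha, _⟩ ⟨c, d⟩ ⟨_, hd⟩ h
  rcases Sym2.eq_iff.1 h with ⟨rfl, rfl⟩ | ⟨rfl, rfl⟩
  · rfl
  · exact absurd ha hd

variable [Fintype V]

lemma ncard_cut (A : Finset V) : (cut A).ncard = #A * (Fintype.card V - #A) := by
  classical
  have hprod : {e : V × V | e.1 ∈ A ∧ e.2 ∉ A} = (A ×ˢ Aᶜ : Finset (V × V)) := by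
    ext e
    simp
  rw [cut, (injOn_sym2Mk_mem_notMem A).ncard_image, hprod, Set.ncard_coe_finset,
    Finset.card_product, Finset.card_compl]

lemma mem_edgeBoundary {G : SimpleGraph V} {A : Finset V} {e : V × V} :
    e ∈ G.edgeBoundary A ↔ G.Adj e.1 e.2 ∧ e.1 ∈ A ∧ e.2 ∉ A := by
  simp [SimpleGraph.edgeBoundary]

lemma card_edgeBoundary_eq_ncard_inter_cut (G : SimpleGraph V) (A : Finset V) :
    #(G.edgeBoundary A) = (G.edgeSet ∩ cut A).ncard := by
  have himage : G.edgeSet ∩ cut A =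
      (fun e : V × V => s(e.1, e.2)) '' (G.edgeBoundary A : Set (V × V)) := by
    ext e
    constructor
    · rintro ⟨he, e, hA, rfl⟩
      exact ⟨e, mem_edgeBoundary.2 ⟨he, hA⟩, rfl⟩
    · rintro ⟨e, he, rfl⟩
      obtain ⟨hadj, hA⟩ := mem_edgeBoundary.1 he
      exact ⟨hadj, e, hA, rfl⟩
  rw [himage, Set.InjOn.ncard_image, Set.ncard_coe_finset]
  exact (injOn_sym2Mk_mem_notMem A).mono fun e he => (mem_edgeBoundary.1 he).2

lemma card_edgeBoundary_singleton (G : SimpleGraph V) [DecidableRel G.Adj] (v : V) :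
    #(G.edgeBoundary {v}) = G.degree v := by
  classical
  have hmap : G.edgeBoundary {v} = {v} ×ˢ G.neighborFinset v := by
    ext ⟨a, b⟩
    simp only [mem_edgeBoundary, Finset.mem_singleton, Finset.mem_product,
      SimpleGraph.mem_neighborFinset]
    constructor
    · rintro ⟨hadj, rfl, -⟩
      exact ⟨rfl, hadj⟩
    · rintro ⟨rfl, hadj⟩
      exact ⟨hadj, rfl, hadj.ne'⟩
  rw [hmap, Finset.card_product, Finset.card_singleton, one_mul,
    SimpleGraph.card_neighborFinset_eq_degree]

lemma hasSubPoissonMGF_card_edgeBoundary (p : unitInterval) (A : Finset V) :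
    HasSubPoissonMGF (fun G : SimpleGraph V => (#(G.edgeBoundary A) : ℝ))
      (p * (#A * (Fintype.card V - #A))) G(V, p) where
  integrable_exp_mul _ := .of_finite
  mgf_le t := by
    have hcut : ∀ s : Set (Sym2 V), (SimpleGraph.fromEdgeSet s).edgeSet ∩ cut A = s ∩ cut A := by
      intro s
      rw [SimpleGraph.edgeSet_fromEdgeSet]
      ext e
      have := @cut_subset_compl_diagSet _ A e
      simp_all
    have h := (hasSubPoissonMGF_ncard_inter_setBernoulli p (cut_subset_compl_diagSet A)).mgf_le t
    rw [ncard_cut, Nat.cast_mul, Nat.cast_sub (Finset.card_le_univ A)] at h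
    rw [SimpleGraph.binomialRandom_eq_map,
      mgf_map SimpleGraph.measurable_fromEdgeSet.aemeasurable .of_discrete]
    simpa only [Function.comp_def, card_edgeBoundary_eq_ncard_inter_cut, hcut] using h

end EdgeBoundary

section FiniteGraph

variable {V : Type*} [Fintype V]

lemma isoperimetricConstant_le_minDegree (G : SimpleGraph V) [DecidableRel G.Adj]
    (hV : 2 ≤ Fintype.card V) : G.isoperimetricConstant ≤ G.minDegree := by
  have : Nonempty V := Fintype.card_pos_iff.1 (by lia)
  obtain ⟨v, hv⟩ := G.exists_minimal_degree_vertex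
  have hV' : (2 : ℝ) ≤ Fintype.card V := mod_cast hV
  refine csInf_le ⟨0, ?_⟩ ⟨{v}, Finset.singleton_nonempty v, ?_, ?_⟩
  · rintro _ ⟨A, -, -, rfl⟩
    positivity
  · rw [Finset.card_singleton, Nat.cast_one]
    linarith
  · rw [card_edgeBoundary_singleton, hv, Finset.card_singleton, Nat.cast_one, div_one]

lemma exists_card_edgeBoundary_lt_of_isoperimetricConstant_lt {G : SimpleGraph V} {c : ℝ}
    (hV : 2 ≤ Fintype.card V) (h : G.isoperimetricConstant < c) :
    ∃ A : Finset V, A.Nonempty ∧ (#A : ℝ) ≤ Fintype.card V / 2 ∧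
      (#(G.edgeBoundary A) : ℝ) < c * #A := by
  obtain ⟨v⟩ : Nonempty V := Fintype.card_pos_iff.1 (by lia)
  have hV' : (2 : ℝ) ≤ Fintype.card V := mod_cast hV
  have hne : {r : ℝ | ∃ A : Finset V, A.Nonempty ∧ (#A : ℝ) ≤ Fintype.card V / 2 ∧
      r = #(G.edgeBoundary A) / #A}.Nonempty := by
    refine ⟨_, {v}, Finset.singleton_nonempty v, ?_, rfl⟩
    rw [Finset.card_singleton, Nat.cast_one]
    linarith
  obtain ⟨_, ⟨A, hA, hA2, rfl⟩, hlt⟩ := exists_lt_of_csInf_lt hne h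
  exact ⟨A, hA, hA2, (div_lt_iff₀ (mod_cast hA.card_pos)).1 hlt⟩

open scoped Classical in
lemma measureReal_lt_maxDegree_le (p : unitInterval) {a : ℝ} (ha : 1 ≤ a) :
    G(V, p).real {G | a * (Fintype.card V * p) < G.maxDegree} ≤
      Fintype.card V * Real.exp (-(Fintype.card V * p * klFun a)) := by
  have hmean : ∀ v : V, (p : ℝ) * (#{v} * (Fintype.card V - #{v})) ≤ Fintype.card V * p := by
    intro v
    rw [Finset.card_singleton]
    push_cast
    linarith [p.2.1]
  have hunion : {G : SimpleGraph V | a * (Fintype.card V * p) < G.maxDegree} ⊆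
      ⋃ v ∈ Finset.univ, {G | a * (Fintype.card V * p) ≤ #(G.edgeBoundary {v})} := by
    intro G hG
    by_contra hsmall
    simp only [Finset.mem_univ, Set.iUnion_true, Set.mem_iUnion, Set.mem_ofPred_eq, not_exists,
      not_le, card_edgeBoundary_singleton] at hsmall
    have hpn : 0 ≤ a * (Fintype.card V * p) :=
      mul_nonneg (by linarith) (mul_nonneg (Nat.cast_nonneg _) p.2.1)
    have hmax : G.maxDegree ≤ ⌊a * (Fintype.card V * p)⌋₊ :=
      G.maxDegree_le_of_forall_degree_le _ fun v => Nat.le_floor (hsmall v).le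
    exact hG.not_ge ((Nat.le_floor_iff hpn).1 hmax)
  calc G(V, p).real {G | a * (Fintype.card V * p) < G.maxDegree}
      ≤ ∑ v : V, G(V, p).real {G | a * (Fintype.card V * p) ≤ #(G.edgeBoundary {v})} :=
        (measureReal_mono hunion (measure_ne_top _ _)).trans (measureReal_biUnion_finset_le _ _)
    _ ≤ ∑ _v : V, Real.exp (-(Fintype.card V * p * klFun a)) :=
        Finset.sum_le_sum fun v _ =>
          (hasSubPoissonMGF_card_edgeBoundary p {v}).measureReal_ge_le (hmean v) ha
    _ = Fintype.card V * Real.exp (-(Fintype.card V * p * klFun a)) := by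
        rw [Finset.sum_const, Finset.card_univ, nsmul_eq_mul]

variable {a β : ℝ}

lemma measureReal_card_edgeBoundary_le (p : unitInterval) {A : Finset V} {c : ℝ}
    (hA : #A ≤ (1 - c) * Fintype.card V) (ha0 : 0 < a) (ha1 : a ≤ 1) :
    G(V, p).real {G | (#(G.edgeBoundary A) : ℝ) ≤ a * (c * (Fintype.card V * p * #A))} ≤
      Real.exp (-(c * (Fintype.card V * p * #A) * klFun a)) := by
  refine (hasSubPoissonMGF_card_edgeBoundary p A).measureReal_le_le ?_ ha0 ha1
  have hpA : 0 ≤ (p : ℝ) * #A := mul_nonneg p.2.1 (Nat.cast_nonneg _)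
  calc c * (Fintype.card V * p * #A) = p * #A * (c * Fintype.card V) := by ring
    _ ≤ p * #A * (Fintype.card V - #A) := mul_le_mul_of_nonneg_left (by linarith) hpA
    _ = p * (#A * (Fintype.card V - #A)) := by ring

lemma measureReal_card_edgeBoundary_lt_le (p : unitInterval) {A : Finset V}
    (hA : #A ≤ (Fintype.card V : ℝ) / 2) (ha0 : 0 < a) (ha1 : a ≤ 1) (hβ : 1 / 2 ≤ β)
    (haβ : β ≤ klFun a) :
    G(V, p).real {G | (#(G.edgeBoundary A) : ℝ) < a / 2 * (Fintype.card V * p) * #A} ≤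
      Real.exp (-(β ^ 2 * (Fintype.card V * p))) ^ #A +
        Real.exp (-(β * (1 - β) / 2 * (Fintype.card V * p))) ^ Fintype.card V := by
  have hm : 0 ≤ Fintype.card V * (p : ℝ) := mul_nonneg (Nat.cast_nonneg _) p.2.1
  have hmA : 0 ≤ Fintype.card V * (p : ℝ) * #A := mul_nonneg hm (Nat.cast_nonneg _)
  have htail : ∀ c : ℝ, 1 / 2 ≤ c → #A ≤ (1 - c) * Fintype.card V →
      G(V, p).real {G | (#(G.edgeBoundary A) : ℝ) < a / 2 * (Fintype.card V * p) * #A} ≤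
        Real.exp (-(c * (Fintype.card V * p * #A) * β)) := by
    intro c hc hAc
    refine (measureReal_mono fun G hG => ?_).trans
      ((measureReal_card_edgeBoundary_le p hAc ha0 ha1).trans (Real.exp_le_exp.2 ?_))
    · refine (Set.mem_ofPred_eq ▸ hG : _ < _).le.trans ?_
      calc a / 2 * (Fintype.card V * p) * #A = a * (1 / 2 * (Fintype.card V * p * #A)) := by ring
        _ ≤ a * (c * (Fintype.card V * p * #A)) := by gcongr
    · gcongr
  rcases le_total (#A : ℝ) ((1 - β) * Fintype.card V) with hsmall | hlarge
  · refine (htail β hβ hsmall).trans (le_add_of_le_of_nonneg ?_ (by positivity))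
    rw [← Real.exp_nat_mul]
    exact Real.exp_le_exp.2 (by linarith)
  · refine (htail (1 / 2) le_rfl (by linarith)).trans (le_add_of_nonneg_of_le (by positivity) ?_)
    rw [← Real.exp_nat_mul]
    refine Real.exp_le_exp.2 ?_
    have hβm : 0 ≤ Fintype.card V * (p : ℝ) * β := by positivity
    nlinarith [mul_le_mul_of_nonneg_left hlarge hβm]

lemma sum_nonempty_pow_card_add_pow_le {x y : ℝ} (hx : 0 ≤ x) (hy : 0 ≤ y) :
    ∑ A : Finset V with A.Nonempty, (x ^ #A + y ^ Fintype.card V) ≤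
      (Real.exp (Fintype.card V * x) - 1) + (2 * y) ^ Fintype.card V := by
  classical
  have hsplit : ∑ A : Finset V with A.Nonempty, x ^ #A = (1 + x) ^ Fintype.card V - 1 := by
    have htotal : ∑ A : Finset V, x ^ #A = (1 + x) ^ Fintype.card V := by
      simpa [add_comm] using Fintype.sum_pow_mul_eq_add_pow V x 1
    have hempty : ∑ A : Finset V with ¬ A.Nonempty, x ^ #A = 1 := by
      simp [Finset.filter_eq']
    rw [← htotal, ← Finset.sum_filter_add_sum_filter_not Finset.univ Finset.Nonempty
      (fun A : Finset V => x ^ #A), hempty, add_sub_cancel_right]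
  have hcard : (#{A : Finset V | A.Nonempty} : ℝ) ≤ 2 ^ Fintype.card V := by
    exact_mod_cast (Finset.card_le_univ _).trans_eq Fintype.card_finset
  have hexp : (1 + x) ^ Fintype.card V ≤ Real.exp (Fintype.card V * x) := by
    rw [Real.exp_nat_mul]
    gcongr
    linarith [Real.add_one_le_exp x]
  rw [Finset.sum_add_distrib, hsplit, Finset.sum_const, nsmul_eq_mul, mul_pow]
  gcongr

lemma measureReal_isoperimetricConstant_lt_le (p : unitInterval) (hV : 2 ≤ Fintype.card V)
    (ha0 : 0 < a) (ha1 : a ≤ 1) (hβ : 1 / 2 ≤ β) (haβ : β ≤ klFun a) :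
    G(V, p).real {G | G.isoperimetricConstant < a / 2 * (Fintype.card V * p)} ≤
      (Real.exp (Fintype.card V * Real.exp (-(β ^ 2 * (Fintype.card V * p)))) - 1) +
        (2 * Real.exp (-(β * (1 - β) / 2 * (Fintype.card V * p)))) ^ Fintype.card V := by
  classical
  let S : Finset (Finset V) := {A | A.Nonempty ∧ (#A : ℝ) ≤ Fintype.card V / 2}
  have hunion : {G : SimpleGraph V | G.isoperimetricConstant < a / 2 * (Fintype.card V * p)} ⊆
      ⋃ A ∈ S, {G | (#(G.edgeBoundary A) : ℝ) < a / 2 * (Fintype.card V * p) * #A} := by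
    intro G hG
    obtain ⟨A, hA, hA2, hlt⟩ := exists_card_edgeBoundary_lt_of_isoperimetricConstant_lt hV hG
    exact Set.mem_biUnion (by simp [S, hA, hA2]) hlt
  calc G(V, p).real {G | G.isoperimetricConstant < a / 2 * (Fintype.card V * p)}
      ≤ ∑ A ∈ S, G(V, p).real
          {G | (#(G.edgeBoundary A) : ℝ) < a / 2 * (Fintype.card V * p) * #A} :=
        (measureReal_mono hunion (measure_ne_top _ _)).trans (measureReal_biUnion_finset_le _ _)
    _ ≤ ∑ A ∈ S, (Real.exp (-(β ^ 2 * (Fintype.card V * p))) ^ #A +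
          Real.exp (-(β * (1 - β) / 2 * (Fintype.card V * p))) ^ Fintype.card V) :=
        Finset.sum_le_sum fun A hA => measureReal_card_edgeBoundary_lt_le p
          (Finset.mem_filter.1 hA).2.2 ha0 ha1 hβ haβ
    _ ≤ ∑ A : Finset V with A.Nonempty, (Real.exp (-(β ^ 2 * (Fintype.card V * p))) ^ #A +
          Real.exp (-(β * (1 - β) / 2 * (Fintype.card V * p))) ^ Fintype.card V) :=
        Finset.sum_le_sum_of_subset_of_nonneg
          (Finset.monotone_filter_right _ fun A _ hA => hA.1) fun _ _ _ => by positivity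
    _ ≤ _ := sum_nonempty_pow_card_add_pow_le (Real.exp_pos _).le (Real.exp_pos _).le

end FiniteGraph

section Asymptotics

variable {p : ℕ → unitInterval} {P Q : (n : ℕ) → SimpleGraph (Fin n) → Prop}

lemma asymptoticallyAlmostSurely_iff_tendsto_measureReal_not :
    AsymptoticallyAlmostSurely p P ↔
      Tendsto (fun n => G(Fin n, p n).real {G | ¬ P n G}) atTop (𝓝 0) := by
  have hcompl : ∀ n, G(Fin n, p n).real {G | ¬ P n G} = 1 - G(Fin n, p n).real {G | P n G} :=
    fun n => probReal_compl_eq_one_sub .of_discrete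
  have hreal : AsymptoticallyAlmostSurely p P ↔
      Tendsto (fun n => G(Fin n, p n).real {G | P n G}) atTop (𝓝 1) := by
    rw [AsymptoticallyAlmostSurely, ← ENNReal.tendsto_toReal_iff (fun _ => measure_ne_top _ _)
      ENNReal.one_ne_top]
    rfl
  rw [hreal]
  simp only [hcompl]
  refine ⟨fun h => ?_, fun h => ?_⟩
  · simpa using h.const_sub 1
  · simpa using h.const_sub 1

namespace AsymptoticallyAlmostSurely

lemma mono (h : AsymptoticallyAlmostSurely p P) (hPQ : ∀ᶠ n in atTop, ∀ G, P n G → Q n G) :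
    AsymptoticallyAlmostSurely p Q :=
  tendsto_of_tendsto_of_tendsto_of_le_of_le' h tendsto_const_nhds
    (hPQ.mono fun _ hn => measure_mono hn) (.of_forall fun _ => prob_le_one)

lemma and (hP : AsymptoticallyAlmostSurely p P) (hQ : AsymptoticallyAlmostSurely p Q) :
    AsymptoticallyAlmostSurely p fun n G => P n G ∧ Q n G := by
  rw [asymptoticallyAlmostSurely_iff_tendsto_measureReal_not] at *
  refine squeeze_zero (fun _ => measureReal_nonneg) (fun n => ?_) (by simpa using hP.add hQ)
  refine (measureReal_mono fun G hG => ?_).trans (measureReal_union_le _ _)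
  exact not_and_or.1 hG

end AsymptoticallyAlmostSurely

lemma exists_one_lt_mul_le_of_limsup_ofReal_div_lt_one {ι : Type*} {l : Filter ι} {f g : ι → ℝ}
    (hf : ∀ᶠ i in l, 0 < f i)
    (h : limsup (fun i => ENNReal.ofReal (f i) / ENNReal.ofReal (g i)) l < 1) :
    ∃ ρ : ℝ, 1 < ρ ∧ ∀ᶠ i in l, ρ * f i ≤ g i := by
  obtain ⟨r, hr0, hr1⟩ := exists_between h
  lift r to NNReal using hr1.ne_top
  have hrpos : (0 : ℝ) < r := NNReal.coe_pos.2 (ENNReal.coe_pos.1 (pos_of_gt hr0))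
  refine ⟨(r : ℝ)⁻¹, (one_lt_inv₀ hrpos).2 (mod_cast hr1), ?_⟩
  filter_upwards [hf, eventually_lt_of_limsup_lt hr0] with i hfi hi
  have hgi : 0 < g i := by
    by_contra! hgi
    rw [ENNReal.ofReal_of_nonpos hgi, ENNReal.div_zero (by simpa using hfi)] at hi
    exact not_top_lt hi
  rw [← ENNReal.ofReal_div_of_pos hgi, ENNReal.ofReal_lt_coe_iff (by positivity),
    div_lt_iff₀ hgi] at hi
  exact (inv_mul_le_iff₀ hrpos).2 hi.le

lemma tendsto_natCast_mul_exp_neg {f : ℕ → ℝ} {c : ℝ} (hc : 1 < c)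
    (hf : ∀ᶠ n : ℕ in atTop, c * Real.log n ≤ f n) :
    Tendsto (fun n : ℕ => n * Real.exp (-f n)) atTop (𝓝 0) := by
  have hpow : Tendsto (fun n : ℕ => (n : ℝ) ^ (-(c - 1))) atTop (𝓝 0) :=
    (tendsto_rpow_neg_atTop (by linarith)).comp tendsto_natCast_atTop_atTop
  refine squeeze_zero' (.of_forall fun n => by positivity) ?_ hpow
  filter_upwards [hf, eventually_gt_atTop 0] with n hfn hn
  have hn' : (0 : ℝ) < n := mod_cast hn
  calc n * Real.exp (-f n) ≤ n * Real.exp (-(c * Real.log n)) := by gcongr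
    _ = (n : ℝ) ^ (-(c - 1)) := by
        rw [neg_sub, sub_eq_add_neg, Real.rpow_add hn', Real.rpow_one, Real.rpow_def_of_pos hn']
        ring_nf

lemma tendsto_pow_self_of_tendsto_zero {f : ℕ → ℝ} (hf0 : ∀ n, 0 ≤ f n)
    (hf : Tendsto f atTop (𝓝 0)) : Tendsto (fun n => f n ^ n) atTop (𝓝 0) := by
  refine squeeze_zero' (.of_forall fun n => pow_nonneg (hf0 n) n) ?_ hf
  filter_upwards [hf.eventually_le_const one_pos, eventually_ne_atTop 0] with n hn hn0
  exact pow_le_of_le_one (hf0 n) hn hn0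

lemma eventually_log_natCast_pos : ∀ᶠ n : ℕ in atTop, 0 < Real.log n :=
  (Real.tendsto_log_atTop.comp tendsto_natCast_atTop_atTop).eventually_gt_atTop 0

open scoped Classical in
lemma asymptoticallyAlmostSurely_maxDegree_le
    (hp : ∀ᶠ n : ℕ in atTop, Real.log n ≤ n * (p n : ℝ)) :
    AsymptoticallyAlmostSurely p fun n G =>
      (G.maxDegree : ℝ) ≤ (1 + √(Real.log n / (n * (p n : ℝ))) * √3) * (n * (p n : ℝ)) := by
  have hrate : ∀ᶠ n : ℕ in atTop, klFun (1 + √3) * Real.log n ≤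
      n * (p n : ℝ) * klFun (1 + √(Real.log n / (n * (p n : ℝ))) * √3) := by
    filter_upwards [hp, eventually_log_natCast_pos] with n hpn hlog
    have hm : 0 < n * (p n : ℝ) := hlog.trans_le hpn
    calc klFun (1 + √3) * Real.log n
        = n * p n * (√(Real.log n / (n * p n)) ^ 2 * klFun (1 + √3)) := by
          rw [Real.sq_sqrt (by positivity), ← mul_assoc, mul_div_cancel₀ _ hm.ne', mul_comm]
      _ ≤ n * p n * klFun (1 + √(Real.log n / (n * p n)) * √3) :=
          mul_le_mul_of_nonneg_left (sq_mul_klFun_one_add_le (Real.sqrt_nonneg _)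
            (Real.sqrt_nonneg _) (Real.sqrt_le_one.2 ((div_le_one hm).2 hpn))) hm.le
  rw [asymptoticallyAlmostSurely_iff_tendsto_measureReal_not]
  refine squeeze_zero (fun _ => measureReal_nonneg) (fun n => ?_)
    (tendsto_natCast_mul_exp_neg one_lt_klFun_one_add_sqrt_three hrate)
  simpa only [not_le, Fintype.card_fin] using measureReal_lt_maxDegree_le (V := Fin n) (p n)
    (le_add_of_nonneg_right (by positivity))

lemma exists_asymptoticallyAlmostSurely_le_isoperimetricConstant {ρ : ℝ} (hρ : 1 < ρ)
    (hp : ∀ᶠ n : ℕ in atTop, ρ * Real.log n ≤ n * (p n : ℝ)) :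
    ∃ α : ℝ, 0 < α ∧ AsymptoticallyAlmostSurely p fun n G =>
      α * (n * (p n : ℝ)) ≤ G.isoperimetricConstant := by
  obtain ⟨β, hβ1, hβ, hβρ⟩ : ∃ β : ℝ, β < 1 ∧ 1 / 2 < β ∧ 1 < β ^ 2 * ρ := by
    have hcont : ContinuousAt (fun β : ℝ => β ^ 2 * ρ) 1 := by fun_prop
    have hlt : ∀ᶠ β : ℝ in 𝓝 1, 1 < β ^ 2 * ρ :=
      hcont.eventually_const_lt (by simpa using hρ)
    exact (eventually_mem_nhdsWithin.and (((eventually_gt_nhds (by norm_num)).and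
      hlt).filter_mono nhdsWithin_le_nhds) : ∀ᶠ β in 𝓝[<] (1 : ℝ), _).exists
  obtain ⟨a, ha0, ha1, haβ⟩ : ∃ a : ℝ, 0 < a ∧ a < 1 ∧ β < klFun a := by
    have hlt : ∀ᶠ a : ℝ in 𝓝 0, β < klFun a :=
      continuous_klFun.continuousAt.eventually_const_lt (by simpa [klFun_zero] using hβ1)
    exact (eventually_mem_nhdsWithin.and (((eventually_lt_nhds one_pos).and
      hlt).filter_mono nhdsWithin_le_nhds) : ∀ᶠ a in 𝓝[>] (0 : ℝ), _).exists
  have hsmall : Tendsto (fun n : ℕ => Real.exp (n * Real.exp (-(β ^ 2 * (n * p n)))) - 1)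
      atTop (𝓝 0) := by
    have hrate : ∀ᶠ n : ℕ in atTop, β ^ 2 * ρ * Real.log n ≤ β ^ 2 * (n * p n) :=
      hp.mono fun n hpn => by
        rw [mul_assoc]
        gcongr
    simpa using ((Real.continuous_exp.tendsto 0).comp
      (tendsto_natCast_mul_exp_neg hβρ hrate)).sub_const 1
  have hlarge : Tendsto (fun n : ℕ => (2 * Real.exp (-(β * (1 - β) / 2 * (n * p n)))) ^ n)
      atTop (𝓝 0) := by
    have hmean : Tendsto (fun n : ℕ => n * (p n : ℝ)) atTop atTop :=
      tendsto_atTop_mono' _ hp ((Real.tendsto_log_atTop.comp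
        tendsto_natCast_atTop_atTop).const_mul_atTop (by positivity))
    have hrate : 0 < β * (1 - β) / 2 := by nlinarith
    refine tendsto_pow_self_of_tendsto_zero (fun n => by positivity) ?_
    simpa using (Real.tendsto_exp_neg_atTop_nhds_zero.comp
      (hmean.const_mul_atTop hrate)).const_mul 2
  refine ⟨a / 2, by positivity, ?_⟩
  rw [asymptoticallyAlmostSurely_iff_tendsto_measureReal_not]
  refine squeeze_zero' (.of_forall fun _ => measureReal_nonneg) ?_
    (by simpa using hsmall.add hlarge)
  filter_upwards [eventually_ge_atTop 2] with n hn
  simpa only [not_le, Fintype.card_fin] using measureReal_isoperimetricConstant_lt_le (V := Fin n)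
    (p n) (by simpa using hn) ha0 ha1.le hβ.le haβ.le

end Asymptotics

open scoped Classical in
theorem lemma2_general (p : ℕ → unitInterval)
    (hp : Filter.limsup
      (fun n : ℕ => ENNReal.ofReal (Real.log n) / ENNReal.ofReal (n * (p n : ℝ)))
      Filter.atTop < 1) :
    ∃ α : ℝ, 0 < α ∧ ∀ ε : ℝ, 0 ≤ ε →
      AsymptoticallyAlmostSurely p fun n G =>
        α * (n * (p n : ℝ)) ≤ G.isoperimetricConstant ∧
        G.isoperimetricConstant ≤ (G.minDegree : ℝ) ∧
        G.minDegree ≤ G.maxDegree ∧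
        (G.maxDegree : ℝ) ≤ n * (p n : ℝ) *
          (1 + √3 * (Real.log n / (n * (p n : ℝ))) ^ ((1 : ℝ) / 2 - ε)) := by
  obtain ⟨ρ, hρ, hlog⟩ :=
    exists_one_lt_mul_le_of_limsup_ofReal_div_lt_one eventually_log_natCast_pos hp
  have hlog' : ∀ᶠ n : ℕ in atTop, Real.log n ≤ n * (p n : ℝ) := by
    filter_upwards [hlog, eventually_log_natCast_pos] with n hn hpos
    exact (le_mul_of_one_le_left hpos.le hρ.le).trans hn
  obtain ⟨α, hα, hiso⟩ := exists_asymptoticallyAlmostSurely_le_isoperimetricConstant hρ hlog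
  refine ⟨α, hα, fun ε hε => (hiso.and (asymptoticallyAlmostSurely_maxDegree_le hlog')).mono ?_⟩
  filter_upwards [hlog', eventually_log_natCast_pos, eventually_ge_atTop 2] with
    n hpn hpos hn G ⟨hG, hdeg⟩
  have hm : 0 < n * (p n : ℝ) := hpos.trans_le hpn
  have hpow : √(Real.log n / (n * p n)) ≤ (Real.log n / (n * p n)) ^ ((1 : ℝ) / 2 - ε) := by
    rw [Real.sqrt_eq_rpow]
    exact Real.rpow_le_rpow_of_exponent_ge (by positivity) ((div_le_one hm).2 hpn) (by linarith)
  refine ⟨hG, isoperimetricConstant_le_minDegree G (by simpa using hn), G.minDegree_le_maxDegree,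
    hdeg.trans ?_⟩
  rw [mul_comm, mul_comm √3]
  gcongr

open scoped Classical in
theorem lemma2 (p : ℕ → unitInterval)
    (hp : Filter.limsup
      (fun n : ℕ => ENNReal.ofReal (Real.log n) / ENNReal.ofReal (n * (p n : ℝ)))
      Filter.atTop < 1) :
    ∃ α : ℝ, 0 < α ∧ ∀ ε : ℝ, 0 < ε → ε ≤ 1 / 2 →
      AsymptoticallyAlmostSurely p fun n G =>
        α * (n * (p n : ℝ)) ≤ G.isoperimetricConstant ∧
        G.isoperimetricConstant ≤ (G.minDegree : ℝ) ∧
        G.minDegree ≤ G.maxDegree ∧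
        (G.maxDegree : ℝ) ≤ n * (p n : ℝ) *
          (1 + √3 * (Real.log n / (n * (p n : ℝ))) ^ ((1 : ℝ) / 2 - ε)) := by
  obtain ⟨α, hα, h⟩ := lemma2_general p hp
  exact ⟨α, hα, fun ε hε _ => h ε hε.le⟩
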